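/- Let $0<\lambda_1<1<\lambda_2$ and $t>0$ satisfy $\frac{\lambda_1^t+\lambda_2^t}{2}<1$. Then $\lambda_1\lambda_2<1$, and for every real $\epsilon$ with $\lambda_1+\epsilon>0$ and $(\lambda_1+\epsilon)\lambda_2<1$ there is exactly one Borel probability measure $\mu=\mu_{\lambda_1+\epsilon,\lambda_2}$ on $\mathbb{R}$ with $\mu=\frac12 (f_1)_*\mu+\frac12 (f_2)_*\mu$, where $f_1(x)=(\lambda_1+\epsilon)x+1$ and $f_2(x)=\lambda_2x+1$. Let $\nu=(\frac12,\frac12)^{\mathbb{N}}$ be the Bernoulli measure on $\Sigma=\{1,2\}^{\mathbb{N}}$, put $\lambda_1(\epsilon)=\lambda_1+\epsilon$, $\lambda_2(\epsilon)=\lambda_2$, and for $(i_1,i_2,\dots)\in\Sigma$ let $$X(\epsilon)=\sum_{m=0}^{\infty}\lambda_{i_1}(\epsilon)\cdots\lambda_{i_m}(\epsilon),\quad X=X(0),\quad X^{(j)}=\frac{j!}{\lambda_1^j}\sum_{m=1}^{\infty}\lambda_{i_1}\cdots\lambda_{i_m}\binom{o(m)}{j}\quad(j\ge1),$$ where $o(m)$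 is the number of $1$'s among $i_1,\dots,i_m$. For $\nu$-almost every word, the series for $X(\epsilon)$ converges for all $\epsilon$ with $\lambda_1+\epsilon>0$ and $(\lambda_1+\epsilon)\lambda_2<1$, the series for all $X^{(j)}$ converge, $\epsilon\mapsto X(\epsilon)$ is infinitely differentiable at $0$, and $\frac{d^j}{d\epsilon^j}X(\epsilon)|_{\epsilon=0}=X^{(j)}$ for all $j\ge1$. Let $\phi(x)=x^t$. For all sufficiently small $|\epsilon|$ the measure $\mu_{\lambda_1+\epsilon,\lambda_2}$ is concentrated on $[1,\infty)$ and $h(\epsilon)=\int\phi\,d\mu_{\lambda_1+\epsilon,\lambda_2}$ is finite. The function $h$ is infinitely differentiable at $0$, and for every integer $l\ge0$ $$h^{(l)}(0)=\int_\Sigma\frac{d^l}{d\epsilon^l}\phi(X(\epsilon))\Big|_{\epsilon=0}\,d\nu=\int_\Sigma\ \sum_{k_1+2k_2+\cdots+lk_l=l}L(k_1,\dots,k_l)\,\phi^{(k)}(X)\prod_{j=1}^{l}\bigl(X^{(j)}\bigr)^{k_j}\,d\nu ,$$ where the sum is over non-negative integers $k_1,\dots,k_l$, $k=k_1+\cdots+k_l$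 and $L(k_1,\dots,k_l)=\frac{l!}{k_1!(1!)^{k_1}\cdots k_l!(l!)^{k_l}}$; the two integrands are equal $\nu$-almost everywhere and $\nu$-integrable. -/

import Mathlib

open MeasureTheory Filter Topology
open scoped ContDiff

noncomputable section

namespace LinearResponse

/-- `μ` is a stationary measure of the IFS `f_i (x) = lam i * x + 1` (`i = 0, 1`), each map being
chosen with probability `1/2`: a Borel probability measure with `μ = ∑ i, (1/2) (f_i)_* μ`.
The letters `1, 2` are represented by `0, 1 : Fin 2`. -/
def IsStationary (lam : Fin 2 → ℝ) (μ : Measure ℝ) : Prop :=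
  IsProbabilityMeasure μ ∧
    μ = ∑ i : Fin 2, (2⁻¹ : ENNReal) • μ.map (fun x => lam i * x + 1)

/-- The Bernoulli measure `(1/2, 1/2)^ℕ` on the space of infinite words `ℕ → Fin 2`. -/
def bernoulli : Measure (ℕ → Fin 2) :=
  Measure.infinitePi fun _ : ℕ => (PMF.uniformOfFintype (Fin 2)).toMeasure

/-- The product of the ratios of the first `m` letters of the word `w`. -/
def weight (lam : Fin 2 → ℝ) (w : ℕ → Fin 2) (m : ℕ) : ℝ :=
  ∏ k ∈ Finset.range m, lam (w k)

/-- The number of occurrences of the first letter among the first `m` letters of `w`. -/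
def firstCount (w : ℕ → Fin 2) (m : ℕ) : ℕ :=
  ((Finset.range m).filter fun k => w k = 0).card

/-- The symbolic projection `∑_{m ≥ 0} lam_{i_1} ⋯ lam_{i_m}`. -/
def X (lam : Fin 2 → ℝ) (w : ℕ → Fin 2) : ℝ :=
  ∑' m : ℕ, weight lam w m

/-- The formal `j`-th derivative (for `j ≥ 1`) of `X` in the first ratio,
`j! / lam_1 ^ j * ∑_{m ≥ 1} lam_{i_1} ⋯ lam_{i_m} * (o(m) choose j)`. -/
def XDeriv (lam : Fin 2 → ℝ) (j : ℕ) (w : ℕ → Fin 2) : ℝ :=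
  (j.factorial : ℝ) / lam 0 ^ j *
    ∑' m : ℕ, weight lam w (m + 1) * ((firstCount w (m + 1)).choose j : ℝ)

/-- The tuples `(k_1, …, k_l)` of natural numbers with `k_1 + 2 k_2 + ⋯ + l k_l = l`;
the entry `k_j` is `k (j - 1)`. -/
def tuples (l : ℕ) : Finset (Fin l → ℕ) :=
  (Fintype.piFinset fun _ : Fin l => Finset.range (l + 1)).filter
    fun k => ∑ j : Fin l, ((j : ℕ) + 1) * k j = l

theorem mem_tuples (l : ℕ) (k : Fin l → ℕ) :
    k ∈ tuples l ↔ ∑ j : Fin l, ((j : ℕ) + 1) * k j = l := by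
  simp only [tuples, Finset.mem_filter, Fintype.mem_piFinset, Finset.mem_range,
    and_iff_right_iff_imp]
  intro h j
  have h1 : ((j : ℕ) + 1) * k j ≤ ∑ j : Fin l, ((j : ℕ) + 1) * k j :=
    Finset.single_le_sum (f := fun j : Fin l => ((j : ℕ) + 1) * k j)
      (fun _ _ => Nat.zero_le _) (Finset.mem_univ j)
  nlinarith [Nat.zero_le ((j : ℕ) * k j)]

/-- The coefficient `l! / (k_1! (1!)^{k_1} ⋯ k_l! (l!)^{k_l})`. -/
def coeffL (l : ℕ) (k : Fin l → ℕ) : ℝ :=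
  (l.factorial : ℝ) /
    ∏ j : Fin l, ((k j).factorial : ℝ) * ((((j : ℕ) + 1).factorial : ℝ)) ^ k j

/-- The formal `l`-th derivative of `φ ∘ X` in the first ratio. -/
def formalDeriv (φ : ℝ → ℝ) (lam : Fin 2 → ℝ) (l : ℕ) (w : ℕ → Fin 2) : ℝ :=
  ∑ k ∈ tuples l,
    coeffL l k * iteratedDeriv (∑ j : Fin l, k j) φ (X lam w) *
      ∏ j : Fin l, XDeriv lam ((j : ℕ) + 1) w ^ k j

end LinearResponse

end

/-!
Coding the two maps by words, the stationary measure is the law of the projection `X` under the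
Bernoulli measure, and for a fixed word `X` is a power series in the first ratio with nonnegative
coefficients. Its formal derivatives are therefore genuine derivatives, and Faà di Bruno's formula
turns the derivatives of `φ (X ε)` into the stated sum.

The only issue is to integrate these derivatives over words. Cauchy's estimate bounds the `j`-th
derivative of `X` at ratio `c` by `X` at a slightly larger ratio `κ ^ θ * c`, and log-convexity of
a power series with nonnegative coefficients bounds the latter by `X c * X (κ * c) ^ θ`. So every
factor `X⁽ʲ⁾ / X` costs only an arbitrarily small power of `X`, while each derivative of `φ` gains
a factor `X⁻¹`: all derivatives of `φ (X ε)` are dominated by a power `X ^ s` with `s > t` as close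
to `t` as desired, at a ratio as close to the original one as desired. The moment condition is open
in both, so this power is integrable and one may differentiate under the integral sign.

Uniqueness comes from running the random affine maps along a word, started from a stationary law
`μ`: every iterate has law `μ`, and almost surely the iterates converge to `X`.
-/

noncomputable section

namespace LinearResponse

section FaaDiBruno

variable {𝕜 : Type*} [NontriviallyNormedField 𝕜]

theorem iteratedDeriv_comp_congr {φ ψ f g : 𝕜 → 𝕜} {x y : 𝕜} {l : ℕ}
    (hφ : ContDiffAt 𝕜 l φ (f x)) (hf : ContDiffAt 𝕜 l f x)
    (hψ : ContDiffAt 𝕜 l ψ (g y)) (hg : ContDiffAt 𝕜 l g y)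
    (hφψ : ∀ k ≤ l, iteratedDeriv k φ (f x) = iteratedDeriv k ψ (g y))
    (hfg : ∀ j, 1 ≤ j → j ≤ l → iteratedDeriv j f x = iteratedDeriv j g y) :
    iteratedDeriv l (φ ∘ f) x = iteratedDeriv l (ψ ∘ g) y := by
  rw [iteratedDeriv_comp_eq_sum_orderedFinpartition hφ hf le_rfl,
    iteratedDeriv_comp_eq_sum_orderedFinpartition hψ hg le_rfl]
  refine Finset.sum_congr rfl fun c _ => ?_
  rw [hφψ _ c.length_le]
  exact congrArg _ (Finset.prod_congr rfl fun j _ => hfg _ (c.partSize_pos j) (c.partSize_le j))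

theorem iteratedDeriv_sum_mul_pow_zero {ι : Type*} (s : Finset ι) (a : ι → 𝕜) (e : ι → ℕ)
    (l : ℕ) :
    iteratedDeriv l (fun h => ∑ i ∈ s, a i * h ^ e i) 0 =
      ∑ i ∈ s, if e i = l then a i * l.factorial else 0 := by
  rw [iteratedDeriv_fun_sum fun i _ => by fun_prop]
  refine Finset.sum_congr rfl fun i _ => ?_
  rw [iteratedDeriv_const_mul_field, iteratedDeriv_fun_pow_zero]
  aesop

theorem sum_le_of_mem_tuples {l : ℕ} {k : Fin l → ℕ} (hk : k ∈ tuples l) : ∑ j, k j ≤ l := by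
  calc ∑ j, k j ≤ ∑ j : Fin l, ((j : ℕ) + 1) * k j :=
        Finset.sum_le_sum fun j _ => Nat.le_mul_of_pos_left _ (Nat.succ_pos _)
    _ = l := (mem_tuples l k).1 hk

theorem sum_pow_eq_sum_multinomial_mul_pow {l : ℕ} (b : Fin l → 𝕜) (h : 𝕜) (m : ℕ) :
    (∑ j : Fin l, b j * h ^ ((j : ℕ) + 1)) ^ m =
      ∑ k ∈ Finset.piAntidiag Finset.univ m,
        (Nat.multinomial Finset.univ k * ∏ j, b j ^ k j) *
          h ^ ∑ j : Fin l, ((j : ℕ) + 1) * k j := by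
  rw [Finset.sum_pow_eq_sum_piAntidiag]
  refine Finset.sum_congr rfl fun k _ => ?_
  simp only [mul_pow, Finset.prod_mul_distrib, ← pow_mul, Finset.prod_pow_eq_pow_sum, mul_assoc]

theorem iteratedDeriv_sum_mul_sum_pow_zero {l : ℕ} (a : ℕ → 𝕜) (b : Fin l → 𝕜) :
    iteratedDeriv l (fun h : 𝕜 => ∑ m ∈ Finset.range (l + 1),
        a m * (∑ j : Fin l, b j * h ^ ((j : ℕ) + 1)) ^ m) 0 =
      ∑ k ∈ tuples l,
        a (∑ j, k j) * (Nat.multinomial Finset.univ k * ∏ j, b j ^ k j) * l.factorial := by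
  have hmaps : ∀ k ∈ tuples l, ∑ j, k j ∈ Finset.range (l + 1) := fun k hk =>
    Finset.mem_range_succ_iff.2 (sum_le_of_mem_tuples hk)
  simp only [sum_pow_eq_sum_multinomial_mul_pow, Finset.mul_sum, ← mul_assoc (a _)]
  rw [iteratedDeriv_fun_sum fun m _ => by fun_prop, ← Finset.sum_fiberwise_of_maps_to hmaps]
  refine Finset.sum_congr rfl fun m _ => ?_
  have hfiber : (tuples l).filter (fun k => ∑ j, k j = m) =
      (Finset.piAntidiag Finset.univ m).filter
        fun k : Fin l → ℕ => ∑ j : Fin l, ((j : ℕ) + 1) * k j = l := by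
    ext k
    simp [mem_tuples, Finset.mem_piAntidiag, and_comm]
  rw [iteratedDeriv_sum_mul_pow_zero, ← Finset.sum_filter, ← hfiber]
  refine Finset.sum_congr rfl fun k hk => ?_
  rw [(Finset.mem_filter.1 hk).2]

theorem multinomial_mul_prod_div_factorial_eq_coeffL (l : ℕ) (k : Fin l → ℕ) (z : ℝ)
    (b : Fin l → ℝ) :
    z / (∑ j, k j).factorial *
        (Nat.multinomial Finset.univ k * ∏ j, (b j / ((j : ℕ) + 1).factorial) ^ k j) *
        l.factorial =
      coeffL l k * z * ∏ j, b j ^ k j := by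
  have hspec : (∏ j, ((k j).factorial : ℝ)) * Nat.multinomial Finset.univ k =
      (∑ j, k j).factorial := mod_cast Nat.multinomial_spec Finset.univ k
  have hprod : (∏ j, ((k j).factorial : ℝ)) ≠ 0 :=
    Finset.prod_ne_zero_iff.2 fun j _ => by positivity
  have hprod' : (∏ j : Fin l, (((j : ℕ) + 1).factorial : ℝ) ^ k j) ≠ 0 :=
    Finset.prod_ne_zero_iff.2 fun j _ => by positivity
  have hsum : ((∑ j, k j).factorial : ℝ) ≠ 0 := by positivity
  rw [coeffL, Finset.prod_mul_distrib]
  simp only [div_pow, Finset.prod_div_distrib]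
  field_simp
  rw [← hspec]
  ring

theorem iteratedDeriv_comp_eq_sum_tuples {φ f : ℝ → ℝ} {x : ℝ} {l : ℕ}
    (hφ : ContDiffAt ℝ l φ (f x)) (hf : ContDiffAt ℝ l f x) :
    iteratedDeriv l (φ ∘ f) x = ∑ k ∈ tuples l,
      coeffL l k * iteratedDeriv (∑ j, k j) φ (f x) *
        ∏ j : Fin l, iteratedDeriv ((j : ℕ) + 1) f x ^ k j := by
  -- Only the derivatives of order at most `l` matter, so `φ` and `f` may be replaced by their
  -- Taylor polynomials, for which the formula is the multinomial theorem.
  set a : ℕ → ℝ := fun m => iteratedDeriv m φ (f x) / m.factorial with ha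
  set b : Fin l → ℝ := fun j => iteratedDeriv ((j : ℕ) + 1) f x / ((j : ℕ) + 1).factorial with hb
  let ψ : ℝ → ℝ := fun y => ∑ m ∈ Finset.range (l + 1), a m * y ^ m
  let g : ℝ → ℝ := fun h => ∑ j : Fin l, b j * h ^ ((j : ℕ) + 1)
  have hg0 : g 0 = 0 := by simp [g]
  have hψ : ContDiff ℝ l ψ := by fun_prop
  have hg : ContDiff ℝ l g := by fun_prop
  have hφψ : ∀ m ≤ l, iteratedDeriv m φ (f x) = iteratedDeriv m ψ (g 0) := by
    intro m hm
    rw [hg0, iteratedDeriv_sum_mul_pow_zero, Finset.sum_ite_eq', if_pos (by simpa using hm), ha]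
    field_simp
  have hfg : ∀ j, 1 ≤ j → j ≤ l → iteratedDeriv j f x = iteratedDeriv j g 0 := by
    intro j hj hjl
    obtain ⟨i, rfl⟩ := Nat.exists_eq_add_of_le' hj
    rw [iteratedDeriv_sum_mul_pow_zero, Finset.sum_eq_single ⟨i, hjl⟩
      (by simp +contextual [Fin.ext_iff]) (by simp), if_pos rfl, hb]
    field_simp
  rw [iteratedDeriv_comp_congr hφ hf hψ.contDiffAt hg.contDiffAt hφψ hfg]
  refine (iteratedDeriv_sum_mul_sum_pow_zero a b).trans (Finset.sum_congr rfl fun k _ => ?_)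
  exact multinomial_mul_prod_div_factorial_eq_coeffL l k _ _

end FaaDiBruno

section DerivativeChain

variable {𝕜 E : Type*} [NontriviallyNormedField 𝕜] [NormedAddCommGroup E] [NormedSpace 𝕜 E]
  {H : ℕ → 𝕜 → E} {U : Set 𝕜}

theorem eqOn_iteratedDeriv_of_hasDerivAt (hU : IsOpen U)
    (hH : ∀ l, ∀ x ∈ U, HasDerivAt (H l) (H (l + 1) x) x) (l : ℕ) :
    U.EqOn (iteratedDeriv l (H 0)) (H l) := by
  induction l with
  | zero => simp [Set.EqOn]
  | succ l ih =>
    intro x hx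
    rw [iteratedDeriv_succ, (ih.eventuallyEq_of_mem (hU.mem_nhds hx)).deriv_eq, (hH l x hx).deriv]

theorem contDiffOn_infty_of_hasDerivAt (hU : IsOpen U)
    (hH : ∀ l, ∀ x ∈ U, HasDerivAt (H l) (H (l + 1) x) x) (l : ℕ) : ContDiffOn 𝕜 ∞ (H l) U := by
  refine contDiffOn_infty.2 fun n => ?_
  induction n generalizing l with
  | zero => exact contDiffOn_zero.2 fun x hx => (hH l x hx).continuousAt.continuousWithinAt
  | succ n ih =>
    rw [Nat.cast_succ, contDiffOn_succ_iff_deriv_of_isOpen hU]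
    exact ⟨fun x hx => (hH l x hx).differentiableAt.differentiableWithinAt, by simp,
      (ih (l + 1)).congr fun x hx => (hH l x hx).deriv⟩

end DerivativeChain

section Translation

variable {𝕜 F : Type*} [NontriviallyNormedField 𝕜] [NormedAddCommGroup F] [NormedSpace 𝕜 F]
  {f : 𝕜 → F} {a : 𝕜}

theorem contDiffAt_zero_comp_const_add {n : WithTop ℕ∞} (hf : ContDiffAt 𝕜 n f a) :
    ContDiffAt 𝕜 n (fun x => f (a + x)) 0 :=
  ContDiffAt.comp 0 (by rwa [add_zero]) (contDiffAt_const.add contDiffAt_id)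

theorem iteratedDeriv_zero_comp_const_add (n : ℕ) :
    iteratedDeriv n (fun x => f (a + x)) 0 = iteratedDeriv n f a := by
  simp only [iteratedDeriv_comp_const_add, add_zero]

end Translation

section MonomialSeries

variable {ι 𝕜 : Type*} [RCLike 𝕜]

/-- The sum of the generalized power series `∑ i, β i * c ^ o i`, in which every exponent may be
repeated infinitely often; in its application `i` counts the letters of a prefix of a word. -/
def monomialSum (β : ι → 𝕜) (o : ι → ℕ) (c : 𝕜) : 𝕜 :=
  ∑' i, β i * c ^ o i

/-- The `j`-th Taylor coefficient at `c` of `monomialSum β o`. -/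
def monomialCoeff (β : ι → 𝕜) (o : ι → ℕ) (j : ℕ) (c : 𝕜) : 𝕜 :=
  ∑' i, β i * ((o i).choose j * c ^ (o i - j))

theorem hasSum_choose_mul_pow_mul_pow (n : ℕ) (c h : 𝕜) :
    HasSum (fun j => n.choose j * c ^ (n - j) * h ^ j) ((c + h) ^ n) := by
  rw [add_comm, add_pow]
  have hterm : ∀ j, h ^ j * c ^ (n - j) * n.choose j = n.choose j * c ^ (n - j) * h ^ j :=
    fun j => by ring
  simp only [hterm]
  refine hasSum_sum_of_ne_finset_zero fun j hj => ?_
  rw [Nat.choose_eq_zero_of_lt (by simpa using hj)]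
  simp

variable {β : ι → 𝕜} {o : ι → ℕ} {c h : 𝕜}

theorem summable_prod_monomialCoeff
    (hs : Summable fun i => ‖β i‖ * (‖c‖ + ‖h‖) ^ o i) :
    Summable fun p : ι × ℕ => β p.1 * ((o p.1).choose p.2 * c ^ (o p.1 - p.2)) * h ^ p.2 := by
  have hinner : ∀ i, HasSum
      (fun j => ‖β i‖ * ((o i).choose j * ‖c‖ ^ (o i - j)) * ‖h‖ ^ j)
      (‖β i‖ * (‖c‖ + ‖h‖) ^ o i) := fun i => by
    simpa only [mul_assoc] using (hasSum_choose_mul_pow_mul_pow (o i) ‖c‖ ‖h‖).mul_left ‖β i‖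
  refine Summable.of_norm ?_
  simp only [norm_mul, norm_pow, RCLike.norm_natCast]
  rw [summable_prod_of_nonneg fun p => by simp only [Pi.zero_apply]; positivity]
  exact ⟨fun i => (hinner i).summable, by simpa only [(hinner _).tsum_eq] using hs⟩

theorem summable_monomialCoeff (hh : h ≠ 0) (hs : Summable fun i => ‖β i‖ * (‖c‖ + ‖h‖) ^ o i)
    (j : ℕ) : Summable fun i => β i * ((o i).choose j * c ^ (o i - j)) :=
  (summable_mul_right_iff (pow_ne_zero j hh)).1
    ((summable_prod_monomialCoeff hs).prod_symm.prod_factor j)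

theorem hasSum_monomialCoeff_mul_pow (hs : Summable fun i => ‖β i‖ * (‖c‖ + ‖h‖) ^ o i) :
    HasSum (fun j => monomialCoeff β o j c * h ^ j) (monomialSum β o (c + h)) := by
  have hprod := summable_prod_monomialCoeff hs
  have hrow : HasSum (fun i => β i * (c + h) ^ o i) (∑' p : ι × ℕ, _) :=
    hprod.hasSum.prod_fiberwise fun i => by
      simpa only [mul_assoc] using (hasSum_choose_mul_pow_mul_pow (o i) c h).mul_left (β i)
  have hcol := hprod.prod_symm.hasSum.prod_fiberwise fun j =>
    (hprod.prod_symm.prod_factor j).hasSum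
  simp only [Prod.fst_swap, Prod.snd_swap, tsum_mul_right] at hcol
  rwa [monomialSum, hrow.tsum_eq, ← (Equiv.prodComm ℕ ι).tsum_eq]

theorem hasFPowerSeriesAt_monomialSum {r : ℝ} (hr : ‖c‖ < r)
    (hs : Summable fun i => ‖β i‖ * r ^ o i) :
    HasFPowerSeriesAt (monomialSum β o)
      (FormalMultilinearSeries.ofScalars 𝕜 fun j => monomialCoeff β o j c) c := by
  rw [hasFPowerSeriesAt_iff]
  filter_upwards [Metric.ball_mem_nhds 0 (sub_pos.2 hr)] with h hh
  have hle : ‖c‖ + ‖h‖ ≤ r := by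
    rw [mem_ball_zero_iff] at hh
    linarith
  simp only [FormalMultilinearSeries.coeff_ofScalars, smul_eq_mul, mul_comm (h ^ _)]
  exact hasSum_monomialCoeff_mul_pow
    (hs.of_nonneg_of_le (fun i => by positivity) fun i => by gcongr)

theorem analyticAt_monomialSum {r : ℝ} (hr : ‖c‖ < r) (hs : Summable fun i => ‖β i‖ * r ^ o i) :
    AnalyticAt 𝕜 (monomialSum β o) c :=
  (hasFPowerSeriesAt_monomialSum hr hs).analyticAt

theorem iteratedDeriv_monomialSum {r : ℝ} (hr : ‖c‖ < r)
    (hs : Summable fun i => ‖β i‖ * r ^ o i) (j : ℕ) :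
    iteratedDeriv j (monomialSum β o) c = j.factorial * monomialCoeff β o j c := by
  have hp := hasFPowerSeriesAt_monomialSum hr hs
  have hcoeff := congrArg (FormalMultilinearSeries.coeff · j)
    (hp.analyticAt.hasFPowerSeriesAt.eq_formalMultilinearSeries hp)
  simp only [FormalMultilinearSeries.coeff_ofScalars] at hcoeff
  rw [← hcoeff, mul_div_cancel₀ _ (Nat.cast_ne_zero.2 j.factorial_ne_zero)]

end MonomialSeries

section NonnegMonomialSeries

variable {ι : Type*} {β : ι → ℝ} {o : ι → ℕ} {c d : ℝ}

theorem summable_mul_pow_of_le (hβ : 0 ≤ β) (hc : 0 ≤ c) (hcd : c ≤ d)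
    (hs : Summable fun i => β i * d ^ o i) : Summable fun i => β i * c ^ o i :=
  hs.of_nonneg_of_le (fun i => mul_nonneg (hβ i) (by positivity)) fun i =>
    mul_le_mul_of_nonneg_left (by gcongr) (hβ i)

theorem monomialSum_le_monomialSum (hβ : 0 ≤ β) (hc : 0 ≤ c) (hcd : c ≤ d)
    (hs : Summable fun i => β i * d ^ o i) : monomialSum β o c ≤ monomialSum β o d :=
  (summable_mul_pow_of_le hβ hc hcd hs).tsum_le_tsum
    (fun i => mul_le_mul_of_nonneg_left (by gcongr) (hβ i)) hs

theorem monomialCoeff_nonneg (hβ : 0 ≤ β) (hc : 0 ≤ c) (j : ℕ) : 0 ≤ monomialCoeff β o j c :=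
  tsum_nonneg fun i => mul_nonneg (hβ i) (by positivity)

theorem monomialCoeff_mul_pow_le (hβ : 0 ≤ β) (hc : 0 ≤ c) (hcd : c ≤ d)
    (hs : Summable fun i => β i * d ^ o i) (j : ℕ) :
    monomialCoeff β o j c * (d - c) ^ j ≤ monomialSum β o d := by
  have hdc : 0 ≤ d - c := sub_nonneg.2 hcd
  have hsum : HasSum (fun j => monomialCoeff β o j c * (d - c) ^ j)
      (monomialSum β o (c + (d - c))) := by
    refine hasSum_monomialCoeff_mul_pow ?_
    simpa only [Real.norm_of_nonneg (hβ _), Real.norm_of_nonneg hc, Real.norm_of_nonneg hdc,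
      add_sub_cancel] using hs
  rw [add_sub_cancel] at hsum
  exact le_hasSum hsum j fun i _ => mul_nonneg (monomialCoeff_nonneg hβ hc i) (by positivity)

theorem monomialSum_rpow_mul_rpow_le {θ : ℝ} (hβ : 0 ≤ β) (hc : 0 ≤ c) (hd : 0 ≤ d) (hθ : 0 < θ)
    (hθ1 : θ < 1) (hsc : Summable fun i => β i * c ^ o i) (hsd : Summable fun i => β i * d ^ o i) :
    monomialSum β o (c ^ (1 - θ) * d ^ θ) ≤
      monomialSum β o c ^ (1 - θ) * monomialSum β o d ^ θ := by
  have h1θ : 0 < 1 - θ := sub_pos.2 hθ1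
  have hnn : ∀ {a : ℝ}, 0 ≤ a → ∀ i, 0 ≤ β i * a ^ o i := fun ha i =>
    mul_nonneg (hβ i) (by positivity)
  have hterm : ∀ i, β i * (c ^ (1 - θ) * d ^ θ) ^ o i =
      (β i * c ^ o i) ^ (1 - θ) * (β i * d ^ o i) ^ θ := by
    intro i
    have hβi : β i = β i ^ (1 - θ) * β i ^ θ := by
      rw [← Real.rpow_add_of_nonneg (hβ i) h1θ.le hθ.le, sub_add_cancel, Real.rpow_one]
    rw [Real.mul_rpow (hβ i) (by positivity), Real.mul_rpow (hβ i) (by positivity), mul_pow,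
      Real.rpow_pow_comm hc, Real.rpow_pow_comm hd, mul_mul_mul_comm, ← hβi]
  have hHolder := Real.inner_le_Lp_mul_Lq_tsum_of_nonneg
    (Real.HolderConjugate.one_sub_inv_inv hθ hθ1)
    (f := fun i => (β i * c ^ o i) ^ (1 - θ)) (g := fun i => (β i * d ^ o i) ^ θ)
    (fun i => Real.rpow_nonneg (hnn hc i) _) (fun i => Real.rpow_nonneg (hnn hd i) _)
    (by simpa only [Real.rpow_rpow_inv (hnn hc _) h1θ.ne'] using hsc)
    (by simpa only [Real.rpow_rpow_inv (hnn hd _) hθ.ne'] using hsd)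
  simpa only [Real.rpow_rpow_inv (hnn hc _) h1θ.ne', Real.rpow_rpow_inv (hnn hd _) hθ.ne',
    one_div, inv_inv, ← hterm, monomialSum] using hHolder

end NonnegMonomialSeries

section Words

variable {α : Type*}

/-- The word obtained by putting the letter `a` in front of the word `w`, i.e. a right inverse of
the shift. -/
def consWord (a : α) (w : ℕ → α) : ℕ → α
  | 0 => a
  | n + 1 => w n

@[simp] theorem consWord_zero (a : α) (w : ℕ → α) : consWord a w 0 = a := rfl

@[simp] theorem consWord_succ (a : α) (w : ℕ → α) (n : ℕ) : consWord a w (n + 1) = w n := rfl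

theorem preimage_consWord_pi (s : Finset ℕ) (t : ℕ → Set α) [Decidable (0 ∈ s)] :
    (fun p : α × (ℕ → α) => consWord p.1 p.2) ⁻¹' Set.pi s t =
      (if 0 ∈ s then t 0 else Set.univ) ×ˢ
        Set.pi (s.preimage Nat.succ Nat.succ_injective.injOn : Finset ℕ) fun n => t (n + 1) := by
  ext ⟨a, w⟩
  simp only [Set.mem_preimage, Set.mem_pi, Set.mem_prod, Finset.mem_coe, Finset.mem_preimage]
  refine ⟨fun h => ⟨?_, fun n hn => h (n + 1) hn⟩, fun h n hn => ?_⟩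
  · split_ifs with h0
    · exact h 0 h0
    · trivial
  · cases n with
    | zero => simpa [hn] using h.1
    | succ n => exact h.2 n hn

variable [MeasurableSpace α]

theorem measurable_consWord_uncurry : Measurable fun p : α × (ℕ → α) => consWord p.1 p.2 :=
  measurable_pi_iff.2 fun n => by
    cases n with
    | zero => exact measurable_fst
    | succ n => exact (measurable_pi_apply n).comp measurable_snd

theorem measurable_consWord (a : α) : Measurable (consWord a) :=
  measurable_consWord_uncurry.comp measurable_prodMk_left

theorem map_consWord_prod_infinitePi (ν : Measure α) [IsProbabilityMeasure ν] :
    (ν.prod (Measure.infinitePi fun _ : ℕ => ν)).map (fun p => consWord p.1 p.2) =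
      Measure.infinitePi fun _ => ν := by
  classical
  refine Measure.eq_infinitePi _ fun s t ht => ?_
  rw [Measure.map_apply measurable_consWord_uncurry
      (MeasurableSet.pi s.countable_toSet fun n _ => ht n),
    preimage_consWord_pi, Measure.prod_prod, Measure.infinitePi_pi _ fun n _ => ht (n + 1),
    Finset.prod_preimage' Nat.succ s _ fun n => ν (t n),
    ← Finset.prod_filter_mul_prod_filter_not s (· = 0), Finset.filter_eq']
  simp only [Nat.range_succ, Set.mem_ofPred_eq, Nat.pos_iff_ne_zero]
  split_ifs <;> simp

end Words

section Bernoulli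

instance : IsProbabilityMeasure bernoulli := by
  unfold bernoulli; infer_instance

theorem toMeasure_uniformOfFintype_fin_two :
    (PMF.uniformOfFintype (Fin 2)).toMeasure =
      ∑ i : Fin 2, (2⁻¹ : ENNReal) • Measure.dirac i := by
  refine Measure.ext_of_singleton fun i => ?_
  rw [PMF.toMeasure_apply_singleton _ _ (measurableSet_singleton i)]
  fin_cases i <;> simp

theorem bernoulli_eq_sum_map_consWord :
    bernoulli = ∑ i : Fin 2, (2⁻¹ : ENNReal) • bernoulli.map (consWord i) := by
  conv_lhs => rw [bernoulli, ← map_consWord_prod_infinitePi, ← bernoulli,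
    toMeasure_uniformOfFintype_fin_two]
  simp only [Fin.sum_univ_two, Measure.add_prod, Measure.prod_smul_left, Measure.dirac_prod]
  rw [Measure.map_add _ _ measurable_consWord_uncurry]
  simp only [Measure.map_smul, Measure.map_map measurable_consWord_uncurry measurable_prodMk_left]
  rfl

end Bernoulli

section Weights

variable {lam : Fin 2 → ℝ} {w : ℕ → Fin 2}

@[simp] theorem weight_zero (lam : Fin 2 → ℝ) (w : ℕ → Fin 2) : weight lam w 0 = 1 := by
  simp [weight]

theorem weight_consWord_succ (lam : Fin 2 → ℝ) (i : Fin 2) (w : ℕ → Fin 2) (m : ℕ) :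
    weight lam (consWord i w) (m + 1) = lam i * weight lam w m := by
  rw [weight, Finset.prod_range_succ', mul_comm]
  rfl

theorem weight_nonneg (hlam : ∀ i, 0 ≤ lam i) (w : ℕ → Fin 2) (m : ℕ) : 0 ≤ weight lam w m :=
  Finset.prod_nonneg fun _ _ => hlam _

theorem measurable_weight (lam : Fin 2 → ℝ) (m : ℕ) : Measurable fun w => weight lam w m :=
  Finset.measurable_fun_prod _ fun k _ =>
    (measurable_of_finite lam).comp (measurable_pi_apply k)

theorem measurable_X (lam : Fin 2 → ℝ) : Measurable (X lam) :=
  Measurable.tsum (measurable_weight lam)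

theorem one_le_X (hlam : ∀ i, 0 ≤ lam i) (hw : Summable (weight lam w)) : 1 ≤ X lam w := by
  simpa [X] using hw.le_tsum 0 fun m _ => weight_nonneg hlam w m

theorem X_consWord (lam : Fin 2 → ℝ) (i : Fin 2) (hw : Summable (weight lam w)) :
    X lam (consWord i w) = lam i * X lam w + 1 := by
  have htail : Summable fun m => weight lam (consWord i w) (m + 1) := by
    simpa only [weight_consWord_succ] using hw.mul_left (lam i)
  rw [X, ((summable_nat_add_iff 1).1 htail).tsum_eq_zero_add]
  simp only [weight_consWord_succ, tsum_mul_left, weight_zero]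
  rw [X, add_comm]

end Weights

section Moments

open scoped ENNReal

theorem tsum_rpow_le_tsum_div_pow_rpow (a : ℕ → ℝ≥0∞) {θ : ℝ≥0∞} (hθ : θ ≠ 0) (hθ' : θ ≠ ⊤)
    {s : ℝ} (hs : 0 < s) :
    (∑' m, a m) ^ s ≤ ((1 - θ)⁻¹) ^ s * ∑' m, (a m / θ ^ m) ^ s := by
  have hterm : ∀ m, a m ≤ θ ^ m * (∑' m, (a m / θ ^ m) ^ s) ^ s⁻¹ := by
    intro m
    rw [mul_comm, ← ENNReal.div_le_iff (pow_ne_zero m hθ) (ENNReal.pow_ne_top hθ'),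
      ENNReal.le_rpow_inv_iff hs]
    exact ENNReal.le_tsum m
  calc (∑' m, a m) ^ s ≤ (∑' m, θ ^ m * (∑' m, (a m / θ ^ m) ^ s) ^ s⁻¹) ^ s :=
        ENNReal.rpow_le_rpow (ENNReal.tsum_le_tsum hterm) hs.le
    _ = ((1 - θ)⁻¹) ^ s * ∑' m, (a m / θ ^ m) ^ s := by
        rw [ENNReal.tsum_mul_right, ENNReal.tsum_geometric, ENNReal.mul_rpow_of_nonneg _ _ hs.le,
          ENNReal.rpow_inv_rpow hs.ne']

theorem lintegral_tsum_rpow_lt_top {Ω : Type*} [MeasurableSpace Ω] {μ : Measure Ω}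
    {f : ℕ → Ω → ℝ≥0∞} (hf : ∀ m, Measurable (f m)) {s : ℝ} (hs : 0 < s) {q : ℝ≥0∞} (hq : q < 1)
    (hfq : ∀ m, ∫⁻ x, f m x ^ s ∂μ ≤ q ^ m) : ∫⁻ x, (∑' m, f m x) ^ s ∂μ < ⊤ := by
  -- Weigh the terms by a geometric sequence that decays slower than the moments do.
  obtain ⟨p, hqp, hp1⟩ := exists_between hq
  have hp0 : p ≠ 0 := (zero_le.trans_lt hqp).ne'
  have hp' : p ≠ ⊤ := hp1.ne_top
  set θ : ℝ≥0∞ := p ^ s⁻¹ with hθ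
  have hθ1 : θ < 1 := ENNReal.rpow_lt_one hp1 (inv_pos.2 hs)
  have hθ0 : θ ≠ 0 := by simp [hθ, hp0, hp', ENNReal.rpow_eq_zero_iff]
  have hθs : ∀ m, (θ ^ m) ^ s = p ^ m := fun m => by
    rw [← ENNReal.rpow_natCast, ← ENNReal.rpow_mul, mul_comm, ENNReal.rpow_mul, hθ,
      ENNReal.rpow_inv_rpow hs.ne', ENNReal.rpow_natCast]
  have hterm : ∀ m, ∫⁻ x, (f m x / θ ^ m) ^ s ∂μ ≤ (q / p) ^ m := fun m => by
    simp only [ENNReal.div_rpow_of_nonneg _ _ hs.le, hθs]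
    simp only [div_eq_mul_inv]
    rw [lintegral_mul_const _ ((hf m).pow_const s), mul_pow, ENNReal.inv_pow]
    gcongr
    exact hfq m
  calc ∫⁻ x, (∑' m, f m x) ^ s ∂μ
      ≤ ∫⁻ x, ((1 - θ)⁻¹) ^ s * ∑' m, (f m x / θ ^ m) ^ s ∂μ :=
        lintegral_mono fun x => tsum_rpow_le_tsum_div_pow_rpow _ hθ0 hθ1.ne_top hs
    _ = ((1 - θ)⁻¹) ^ s * ∑' m, ∫⁻ x, (f m x / θ ^ m) ^ s ∂μ := by
        rw [lintegral_const_mul _ (Measurable.tsum fun m => ((hf m).div_const _).pow_const s),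
          lintegral_tsum fun m => (((hf m).div_const _).pow_const s).aemeasurable]
    _ ≤ ((1 - θ)⁻¹) ^ s * ∑' m, (q / p) ^ m := by
        gcongr with m
        exact hterm m
    _ < ⊤ := by
        rw [ENNReal.tsum_geometric]
        refine ENNReal.mul_lt_top (ENNReal.rpow_lt_top_of_nonneg hs.le ?_) ?_
        · simpa [tsub_eq_zero_iff_le] using hθ1
        · have : q / p < 1 := ENNReal.div_lt_of_lt_mul (by simpa using hqp)
          simpa [tsub_eq_zero_iff_le] using this

/-- The `s`-th moment of the ratio `lam i` of a letter `i` chosen uniformly at random. -/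
def ratioMoment (lam : Fin 2 → ℝ) (s : ℝ) : ℝ :=
  (lam 0 ^ s + lam 1 ^ s) / 2

variable {lam : Fin 2 → ℝ} {s : ℝ}

theorem mul_lt_one_of_ratioMoment_lt_one (hlam : ∀ i, 0 < lam i) (hs : 0 < s)
    (hmoment : ratioMoment lam s < 1) : lam 0 * lam 1 < 1 := by
  by_contra! h
  have hprod : 1 ≤ lam 0 ^ s * lam 1 ^ s := by
    rw [← Real.mul_rpow (hlam 0).le (hlam 1).le]
    exact Real.one_le_rpow h hs.le
  have h0 := Real.rpow_pos_of_pos (hlam 0) s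
  have h1 := Real.rpow_pos_of_pos (hlam 1) s
  rw [ratioMoment] at hmoment
  nlinarith [sq_nonneg (lam 0 ^ s - lam 1 ^ s)]

-- The derivative of `s ↦ ratioMoment lam s` at `0` is `log (lam 0 * lam 1) / 2 < 0`.
theorem exists_ratioMoment_lt_one (hlam : ∀ i, 0 < lam i) (h : lam 0 * lam 1 < 1) :
    ∃ s, 0 < s ∧ ratioMoment lam s < 1 := by
  have hd : HasDerivAt (ratioMoment lam) (Real.log (lam 0 * lam 1) / 2) 0 := by
    have := (((Real.hasStrictDerivAt_const_rpow (hlam 0) 0).hasDerivAt).fun_add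
      ((Real.hasStrictDerivAt_const_rpow (hlam 1) 0).hasDerivAt)).div_const 2
    rw [Real.log_mul (hlam 0).ne' (hlam 1).ne']
    simp only [Real.rpow_zero, one_mul] at this
    exact this
  have hneg : Real.log (lam 0 * lam 1) / 2 < 0 :=
    div_neg_of_neg_of_pos (Real.log_neg (mul_pos (hlam 0) (hlam 1)) h) two_pos
  obtain ⟨s, hs, hs0⟩ := (((hasDerivAt_iff_tendsto_slope.1 hd).mono_left
    (nhdsGT_le_nhdsNE 0)).eventually_lt_const hneg |>.and self_mem_nhdsWithin).exists
  have hs0' : 0 < s := hs0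
  have hzero : ratioMoment lam 0 = 1 := by simp [ratioMoment]
  rw [slope_def_field, sub_zero, div_lt_iff₀ hs0', zero_mul, hzero] at hs
  exact ⟨s, hs0', sub_neg.1 hs⟩

theorem lintegral_bernoulli_eq_sum_consWord {F : (ℕ → Fin 2) → ℝ≥0∞} (hF : Measurable F) :
    ∫⁻ w, F w ∂bernoulli = ∑ i : Fin 2, 2⁻¹ * ∫⁻ w, F (consWord i w) ∂bernoulli := by
  conv_lhs => rw [bernoulli_eq_sum_map_consWord]
  simp only [lintegral_finsetSum_measure, lintegral_smul_measure, smul_eq_mul,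
    lintegral_map hF (measurable_consWord _)]

theorem lintegral_ofReal_weight_rpow (hlam : ∀ i, 0 < lam i) (s : ℝ) (m : ℕ) :
    ∫⁻ w, ENNReal.ofReal (weight lam w m) ^ s ∂bernoulli =
      ENNReal.ofReal (ratioMoment lam s) ^ m := by
  have hratio : ENNReal.ofReal (ratioMoment lam s) =
      ∑ i, 2⁻¹ * ENNReal.ofReal (lam i) ^ s := by
    have h0 := (hlam 0).le
    have h1 := (hlam 1).le
    simp only [Fin.sum_univ_two, ENNReal.ofReal_rpow_of_pos (hlam _)]
    rw [ratioMoment, div_eq_inv_mul, ENNReal.ofReal_mul (by positivity),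
      ENNReal.ofReal_add (by positivity) (by positivity), ENNReal.ofReal_inv_of_pos two_pos,
      ENNReal.ofReal_ofNat, mul_add]
  induction m with
  | zero => simp
  | succ m ih =>
    rw [lintegral_bernoulli_eq_sum_consWord
      ((measurable_weight lam (m + 1)).ennreal_ofReal.pow_const s), pow_succ', hratio,
      Finset.sum_mul, ← hratio]
    refine Finset.sum_congr rfl fun i _ => ?_
    simp only [weight_consWord_succ, ENNReal.ofReal_mul (hlam i).le]
    simp only [ENNReal.mul_rpow_of_ne_top ENNReal.ofReal_ne_top ENNReal.ofReal_ne_top]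
    rw [lintegral_const_mul _ ((measurable_weight lam m).ennreal_ofReal.pow_const s), ih, mul_assoc]

theorem lintegral_tsum_weight_rpow_lt_top (hlam : ∀ i, 0 < lam i) (hs : 0 < s)
    (hmoment : ratioMoment lam s < 1) :
    ∫⁻ w, (∑' m, ENNReal.ofReal (weight lam w m)) ^ s ∂bernoulli < ⊤ :=
  lintegral_tsum_rpow_lt_top (fun m => (measurable_weight lam m).ennreal_ofReal) hs
    (ENNReal.ofReal_lt_one.2 hmoment) fun m => (lintegral_ofReal_weight_rpow hlam s m).le

theorem ae_summable_weight_of_ratioMoment_lt_one (hlam : ∀ i, 0 < lam i) (hs : 0 < s)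
    (hmoment : ratioMoment lam s < 1) : ∀ᵐ w ∂bernoulli, Summable (weight lam w) := by
  have hmeas : Measurable fun w => (∑' m, ENNReal.ofReal (weight lam w m)) ^ s :=
    (Measurable.tsum fun m => (measurable_weight lam m).ennreal_ofReal).pow_const s
  filter_upwards [ae_lt_top hmeas (lintegral_tsum_weight_rpow_lt_top hlam hs hmoment).ne] with w hw
  have hfin := (ENNReal.rpow_lt_top_iff_of_pos hs).1 hw
  simpa only [ENNReal.toReal_ofReal (weight_nonneg (fun i => (hlam i).le) w _)] using
    ENNReal.summable_toReal hfin.ne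

theorem ae_summable_weight (hlam : ∀ i, 0 < lam i) (h : lam 0 * lam 1 < 1) :
    ∀ᵐ w ∂bernoulli, Summable (weight lam w) :=
  let ⟨_, hs, hmoment⟩ := exists_ratioMoment_lt_one hlam h
  ae_summable_weight_of_ratioMoment_lt_one hlam hs hmoment

theorem integrable_X_rpow (hlam : ∀ i, 0 < lam i) (hs : 0 < s) (hmoment : ratioMoment lam s < 1) :
    Integrable (fun w => X lam w ^ s) bernoulli := by
  refine ⟨((measurable_X lam).pow_const s).aestronglyMeasurable, ?_⟩
  have hlam' : ∀ i, 0 ≤ lam i := fun i => (hlam i).le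
  have hX : ∀ w, 0 ≤ X lam w := fun w => tsum_nonneg (weight_nonneg hlam' w)
  rw [hasFiniteIntegral_iff_ofReal (.of_forall fun w => Real.rpow_nonneg (hX w) s)]
  refine (lintegral_congr_ae ?_).trans_lt (lintegral_tsum_weight_rpow_lt_top hlam hs hmoment)
  filter_upwards [ae_summable_weight_of_ratioMoment_lt_one hlam hs hmoment] with w hw
  rw [← ENNReal.ofReal_rpow_of_nonneg (hX w) hs.le, X,
    ENNReal.ofReal_tsum_of_nonneg (weight_nonneg hlam' w) hw]

end Moments

section StationaryMeasure

variable {lam : Fin 2 → ℝ} {w : ℕ → Fin 2}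

theorem isStationary_map_X (hlam : ∀ i, 0 < lam i) (h : lam 0 * lam 1 < 1) :
    IsStationary lam (bernoulli.map (X lam)) := by
  have hX := measurable_X lam
  refine ⟨Measure.isProbabilityMeasure_map hX.aemeasurable, ?_⟩
  have himage : ∀ i, (bernoulli.map (X lam)).map (fun x => lam i * x + 1) =
      (bernoulli.map (consWord i)).map (X lam) := fun i => by
    rw [Measure.map_map (by fun_prop) hX, Measure.map_map hX (measurable_consWord i)]
    refine Measure.map_congr ?_
    filter_upwards [ae_summable_weight hlam h] with w hw
    exact (X_consWord lam i hw).symm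
  conv_lhs => rw [bernoulli_eq_sum_map_consWord]
  simp only [Fin.sum_univ_two, himage, Measure.map_add _ _ hX, Measure.map_smul]

/-- The image of `p.1` under `f_{i_1} ∘ ⋯ ∘ f_{i_n}`, where `f_i x = lam i * x + 1` and
`p.2 = (i_1, i_2, …)`. -/
def affineIterate (lam : Fin 2 → ℝ) (n : ℕ) (p : ℝ × (ℕ → Fin 2)) : ℝ :=
  ∑ m ∈ Finset.range n, weight lam p.2 m + weight lam p.2 n * p.1

theorem measurable_affineIterate (lam : Fin 2 → ℝ) (n : ℕ) : Measurable (affineIterate lam n) :=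
  (Finset.measurable_fun_sum _ fun m _ => (measurable_weight lam m).comp measurable_snd).add
    (((measurable_weight lam n).comp measurable_snd).mul measurable_fst)

theorem affineIterate_succ_consWord (lam : Fin 2 → ℝ) (n : ℕ) (x : ℝ) (i : Fin 2)
    (w : ℕ → Fin 2) :
    affineIterate lam (n + 1) (x, consWord i w) = lam i * affineIterate lam n (x, w) + 1 := by
  simp only [affineIterate, Finset.sum_range_succ', weight_consWord_succ, weight_zero,
    ← Finset.mul_sum]
  ring

theorem tendsto_affineIterate (x : ℝ) (hw : Summable (weight lam w)) :
    Tendsto (fun n => affineIterate lam n (x, w)) atTop (𝓝 (X lam w)) := by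
  simpa [X, affineIterate] using
    hw.hasSum.tendsto_sum_nat.add (hw.tendsto_atTop_zero.mul_const x)

variable {μ : Measure ℝ}

theorem IsStationary.map_affineIterate (hμ : IsStationary lam μ) (n : ℕ) :
    (μ.prod bernoulli).map (affineIterate lam n) = μ := by
  have := hμ.1
  induction n with
  | zero =>
    have hfst : affineIterate lam 0 = Prod.fst := by ext p; simp [affineIterate]
    rw [hfst, Measure.map_fst_prod, measure_univ, one_smul]
  | succ n ih =>
    have hbranch : ∀ i, (μ.prod (bernoulli.map (consWord i))).map (affineIterate lam (n + 1)) =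
        μ.map fun x => lam i * x + 1 := fun i => by
      conv_rhs => rw [← ih]
      conv_lhs => rw [← Measure.map_id (μ := μ)]
      rw [Measure.map_prod_map _ _ measurable_id (measurable_consWord i),
        Measure.map_map (measurable_affineIterate lam _)
          (measurable_id.prodMap (measurable_consWord i)),
        Measure.map_map (by fun_prop) (measurable_affineIterate lam n)]
      congr 1
      ext ⟨x, w⟩
      exact affineIterate_succ_consWord lam n x i w
    conv_lhs => rw [bernoulli_eq_sum_map_consWord]
    conv_rhs => rw [hμ.2]
    simp only [Fin.sum_univ_two, Measure.prod_add, Measure.prod_smul_right,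
      Measure.map_add _ _ (measurable_affineIterate lam _), Measure.map_smul, hbranch]

-- `affineIterate lam n` has law `μ` for every `n` and converges to `X` almost surely.
theorem IsStationary.eq_map_X (hlam : ∀ i, 0 < lam i) (h : lam 0 * lam 1 < 1)
    (hμ : IsStationary lam μ) : μ = bernoulli.map (X lam) := by
  have := hμ.1
  have hmeas := fun n => (measurable_affineIterate lam n).aemeasurable (μ := μ.prod bernoulli)
  have hconst : TendstoInDistribution (affineIterate lam) atTop (id : ℝ → ℝ)
      (fun _ => μ.prod bernoulli) μ :=
    tendstoInDistribution_of_identDistrib 0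
      (fun n => ⟨hmeas 0, hmeas n, by simp only [hμ.map_affineIterate]⟩)
      ⟨hmeas 0, aemeasurable_id, by rw [hμ.map_affineIterate, Measure.map_id]⟩
  have hlim : TendstoInDistribution (affineIterate lam) atTop (X lam ∘ Prod.snd)
      (fun _ => μ.prod bernoulli) (μ.prod bernoulli) := by
    refine tendstoInDistribution_of_ae_tendsto hmeas
      ((measurable_X lam).comp measurable_snd).aemeasurable ?_
    filter_upwards [Measure.quasiMeasurePreserving_snd.ae (ae_summable_weight hlam h)] with p hp
    exact tendsto_affineIterate p.1 hp
  calc μ = μ.map id := Measure.map_id.symm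
    _ = (μ.prod bernoulli).map (X lam ∘ Prod.snd) := tendstoInDistribution_unique _ hconst hlim
    _ = bernoulli.map (X lam) := by
      rw [← Measure.map_map (measurable_X lam) measurable_snd,
        Measure.map_snd_prod, measure_univ, one_smul]

theorem existsUnique_isStationary (hlam : ∀ i, 0 < lam i) (h : lam 0 * lam 1 < 1) :
    ∃! μ : Measure ℝ, IsStationary lam μ :=
  ⟨_, isStationary_map_X hlam h, fun _ hμ => hμ.eq_map_X hlam h⟩

end StationaryMeasure

section FirstRatio

variable {b c d : ℝ} {w : ℕ → Fin 2}

theorem forall_pair_pos (hc : 0 < c) (hb : 0 < b) : ∀ i : Fin 2, 0 < ![c, b] i :=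
  Fin.forall_fin_two.2 ⟨hc, hb⟩

theorem weight_pair_eq_mul_pow (c b : ℝ) (w : ℕ → Fin 2) (m : ℕ) :
    weight ![c, b] w m = weight ![1, b] w m * c ^ firstCount w m := by
  have hletter : ∀ i : Fin 2, ![c, b] i = ![1, b] i * if i = 0 then c else 1 :=
    Fin.forall_fin_two.2 ⟨by simp, by simp⟩
  rw [weight, Finset.prod_congr rfl fun k _ => hletter (w k), Finset.prod_mul_distrib,
    Finset.prod_ite, Finset.prod_const, Finset.prod_const_one, mul_one]
  rfl

theorem X_pair_eq_monomialSum (c b : ℝ) (w : ℕ → Fin 2) :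
    X ![c, b] w = monomialSum (weight ![1, b] w) (firstCount w) c :=
  tsum_congr (weight_pair_eq_mul_pow c b w)

theorem weight_mul_choose_div_pow (hc : c ≠ 0) (b : ℝ) (j : ℕ) (w : ℕ → Fin 2) (m : ℕ) :
    weight ![c, b] w m * (firstCount w m).choose j / c ^ j =
      weight ![1, b] w m * ((firstCount w m).choose j * c ^ (firstCount w m - j)) := by
  rcases lt_or_ge (firstCount w m) j with hlt | hle
  · simp [Nat.choose_eq_zero_of_lt hlt]
  · rw [weight_pair_eq_mul_pow, pow_sub₀ c hc hle]
    ring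

theorem XDeriv_pair_eq_factorial_mul_monomialCoeff (hc : c ≠ 0) (b : ℝ) {j : ℕ} (hj : j ≠ 0)
    (w : ℕ → Fin 2) :
    XDeriv ![c, b] j w = j.factorial * monomialCoeff (weight ![1, b] w) (firstCount w) j c := by
  have hsupport : (Function.support fun m => weight ![1, b] w m *
      ((firstCount w m).choose j * c ^ (firstCount w m - j))) ⊆ Set.range Nat.succ := by
    rintro (_ | m) hm
    · exact absurd (by simp [firstCount, Nat.choose_eq_zero_of_lt (Nat.pos_of_ne_zero hj)]) hm
    · exact ⟨m, rfl⟩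
  rw [monomialCoeff, ← Nat.succ_injective.tsum_eq hsupport, XDeriv, div_mul_eq_mul_div,
    mul_div_assoc, ← tsum_div_const]
  simp only [Matrix.cons_val_zero, weight_mul_choose_div_pow hc, Nat.succ_eq_add_one]

theorem weight_one_pair_nonneg (hb : 0 < b) (w : ℕ → Fin 2) : 0 ≤ weight ![1, b] w :=
  weight_nonneg (fun i => (forall_pair_pos one_pos hb i).le) w

theorem summable_weight_pair_iff : Summable (weight ![c, b] w) ↔
    Summable fun m => weight ![1, b] w m * c ^ firstCount w m :=
  summable_congr (weight_pair_eq_mul_pow c b w)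

theorem summable_norm_weight_one_mul_pow (hb : 0 < b) (hw : Summable (weight ![d, b] w)) :
    Summable fun m => ‖weight ![1, b] w m‖ * d ^ firstCount w m := by
  simpa only [Real.norm_of_nonneg (weight_one_pair_nonneg hb w _)] using
    summable_weight_pair_iff.1 hw

theorem summable_weight_of_le (hb : 0 < b) (hc : 0 < c) (hcd : c ≤ d)
    (hw : Summable (weight ![d, b] w)) : Summable (weight ![c, b] w) :=
  summable_weight_pair_iff.2 <| summable_mul_pow_of_le (weight_one_pair_nonneg hb w) hc.le hcd <|
    summable_weight_pair_iff.1 hw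

theorem ae_forall_summable_weight (hb : 0 < b) :
    ∀ᵐ w ∂bernoulli, ∀ c, 0 < c → c * b < 1 → Summable (weight ![c, b] w) := by
  -- By monotonicity it is enough to treat the countably many rational ratios.
  have hrat : ∀ᵐ w ∂bernoulli, ∀ q : ℚ, 0 < (q : ℝ) → (q : ℝ) * b < 1 →
      Summable (weight ![(q : ℝ), b] w) := by
    simp only [ae_all_iff, eventually_imp_distrib_left]
    exact fun q hq hqb => ae_summable_weight (forall_pair_pos hq hb) hqb
  filter_upwards [hrat] with w hw c hc hcb
  obtain ⟨q, hcq, hqb⟩ := exists_rat_btwn ((lt_div_iff₀ hb).2 hcb)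
  exact summable_weight_of_le hb hc hcq.le (hw q (hc.trans hcq) ((lt_div_iff₀ hb).1 hqb))

theorem analyticAt_X (hb : 0 < b) (hc : 0 < c) (hcd : c < d) (hw : Summable (weight ![d, b] w)) :
    AnalyticAt ℝ (fun c => X ![c, b] w) c := by
  simp only [X_pair_eq_monomialSum]
  exact analyticAt_monomialSum (by rwa [Real.norm_of_nonneg hc.le])
    (summable_norm_weight_one_mul_pow hb hw)

theorem iteratedDeriv_X (hb : 0 < b) (hc : 0 < c) (hcd : c < d)
    (hw : Summable (weight ![d, b] w)) {j : ℕ} (hj : j ≠ 0) :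
    iteratedDeriv j (fun c => X ![c, b] w) c = XDeriv ![c, b] j w := by
  simp only [X_pair_eq_monomialSum, XDeriv_pair_eq_factorial_mul_monomialCoeff hc.ne' b hj]
  exact iteratedDeriv_monomialSum (by rwa [Real.norm_of_nonneg hc.le])
    (summable_norm_weight_one_mul_pow hb hw) j

theorem summable_weight_mul_choose (hb : 0 < b) (hc : 0 < c) (hcd : c < d)
    (hw : Summable (weight ![d, b] w)) (j : ℕ) :
    Summable fun m => weight ![c, b] w m * ((firstCount w m).choose j : ℝ) := by
  have hdc : 0 < d - c := sub_pos.2 hcd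
  have hcoeff := summable_monomialCoeff (o := firstCount w) (c := c) hdc.ne' (by
    simpa only [Real.norm_of_nonneg hc.le, Real.norm_of_nonneg hdc.le, add_sub_cancel] using
      summable_norm_weight_one_mul_pow hb hw) j
  simp only [← weight_mul_choose_div_pow hc.ne'] at hcoeff
  exact (summable_div_const_iff (pow_ne_zero j hc.ne')).1 hcoeff

theorem X_le_X_of_le (hb : 0 < b) (hc : 0 < c) (hcd : c ≤ d) (hw : Summable (weight ![d, b] w)) :
    X ![c, b] w ≤ X ![d, b] w := by
  simpa only [X_pair_eq_monomialSum] using monomialSum_le_monomialSum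
    (weight_one_pair_nonneg hb w) hc.le hcd (summable_weight_pair_iff.1 hw)

end FirstRatio

section SymbolGrowth

/-- `φ` is a smooth symbol of order `t` on `[1, ∞)`: differentiating `k` times lowers the order of
growth by `k`. This is the class of observables for which the linear response formula is proved;
the power `x ^ t` is the model example. -/
structure HasSymbolGrowth (φ : ℝ → ℝ) (t : ℝ) : Prop where
  measurable : Measurable φ
  contDiffAt : ∀ x, 1 ≤ x → ContDiffAt ℝ ∞ φ x
  exists_bound : ∀ k : ℕ, ∃ C : ℝ, ∀ x, 1 ≤ x → |iteratedDeriv k φ x| ≤ C * x ^ (t - k)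

theorem hasSymbolGrowth_rpow (t : ℝ) : HasSymbolGrowth (fun x => x ^ t) t where
  measurable := measurable_id.pow_const t
  contDiffAt x hx := Real.contDiffAt_rpow_const_of_ne (zero_lt_one.trans_le hx).ne'
  exists_bound k := ⟨|(descPochhammer ℝ k).eval t|, fun x hx => by
    rw [iteratedDeriv_eq_iterate, Real.iter_deriv_rpow_const, abs_mul,
      abs_of_nonneg (Real.rpow_nonneg (zero_le_one.trans hx) _)]⟩

theorem measurable_iteratedDeriv {φ : ℝ → ℝ} (hφ : Measurable φ) (k : ℕ) :
    Measurable (iteratedDeriv k φ) := by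
  cases k with
  | zero => rwa [iteratedDeriv_zero]
  | succ k => rw [iteratedDeriv_succ]; exact measurable_deriv _

theorem measurable_firstCount (m : ℕ) : Measurable fun w => firstCount w m := by
  simp only [firstCount, Finset.card_filter]
  exact Finset.measurable_fun_sum _ fun k _ =>
    (measurable_of_finite fun i : Fin 2 => if i = 0 then 1 else 0).comp (measurable_pi_apply k)

theorem measurable_XDeriv (lam : Fin 2 → ℝ) (j : ℕ) : Measurable (XDeriv lam j) :=
  (Measurable.tsum fun m => (measurable_weight lam (m + 1)).mul
    ((measurable_of_countable fun n : ℕ => (n.choose j : ℝ)).comp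
      (measurable_firstCount (m + 1)))).const_mul _

theorem measurable_formalDeriv {φ : ℝ → ℝ} (hφ : Measurable φ) (lam : Fin 2 → ℝ) (l : ℕ) :
    Measurable (formalDeriv φ lam l) :=
  Finset.measurable_fun_sum _ fun _ _ =>
    (((measurable_iteratedDeriv hφ _).comp (measurable_X lam)).const_mul _).mul
      (Finset.measurable_fun_prod _ fun _ _ => (measurable_XDeriv lam _).pow_const _)

theorem formalDeriv_zero (φ : ℝ → ℝ) (lam : Fin 2 → ℝ) (w : ℕ → Fin 2) :
    formalDeriv φ lam 0 w = φ (X lam w) := by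
  have htuples : tuples 0 = {0} := by
    ext k
    simp [mem_tuples, eq_iff_true_of_subsingleton]
  simp [formalDeriv, htuples, coeffL]

variable {φ : ℝ → ℝ} {t b c d : ℝ} {w : ℕ → Fin 2}

theorem contDiffAt_comp_X (hφ : HasSymbolGrowth φ t) (hb : 0 < b) (hc : 0 < c) (hcd : c < d)
    (hw : Summable (weight ![d, b] w)) : ContDiffAt ℝ ∞ (fun c => φ (X ![c, b] w)) c :=
  ContDiffAt.comp c (hφ.contDiffAt _ (one_le_X (fun i => (forall_pair_pos hc hb i).le)
    (summable_weight_of_le hb hc hcd.le hw))) (analyticAt_X hb hc hcd hw).contDiffAt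

theorem iteratedDeriv_comp_X (hφ : HasSymbolGrowth φ t) (hb : 0 < b) (hc : 0 < c) (hcd : c < d)
    (hw : Summable (weight ![d, b] w)) (l : ℕ) :
    iteratedDeriv l (fun c => φ (X ![c, b] w)) c = formalDeriv φ ![c, b] l w := by
  have hX := one_le_X (fun i => (forall_pair_pos hc hb i).le)
    (summable_weight_of_le hb hc hcd.le hw)
  rw [← Function.comp_def φ fun c => X ![c, b] w,
    iteratedDeriv_comp_eq_sum_tuples ((hφ.contDiffAt _ hX).of_le (mod_cast le_top))
      (analyticAt_X hb hc hcd hw).contDiffAt]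
  simp only [iteratedDeriv_X hb hc hcd hw (Nat.succ_ne_zero _), formalDeriv]

theorem hasDerivAt_formalDeriv (hφ : HasSymbolGrowth φ t) (hb : 0 < b) (hc : 0 < c) (hcd : c < d)
    (hw : Summable (weight ![d, b] w)) (l : ℕ) :
    HasDerivAt (fun c => formalDeriv φ ![c, b] l w) (formalDeriv φ ![c, b] (l + 1) w) c := by
  have hdiff : DifferentiableAt ℝ (iteratedDeriv l fun c => φ (X ![c, b] w)) c := by
    rw [iteratedDeriv_eq_equiv_comp, LinearIsometryEquiv.comp_differentiableAt_iff]
    exact (contDiffAt_comp_X hφ hb hc hcd hw).differentiableAt_iteratedFDeriv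
      (mod_cast ENat.natCast_lt_top l)
  have hderiv := hdiff.hasDerivAt
  rw [← iteratedDeriv_succ, iteratedDeriv_comp_X hφ hb hc hcd hw] at hderiv
  refine hderiv.congr_of_eventuallyEq ?_
  filter_upwards [Ioo_mem_nhds hc hcd] with e he
  exact (iteratedDeriv_comp_X hφ hb he.1 he.2 hw l).symm

end SymbolGrowth

section Bounds

variable {b c d κ θ : ℝ} {w : ℕ → Fin 2}

theorem X_rpow_mul_le (hb : 0 < b) (hc : 0 < c) (hκ : 1 < κ) (hκd : κ * c ≤ d) (hθ : 0 < θ)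
    (hθ1 : θ < 1) (hw : Summable (weight ![d, b] w)) :
    X ![κ ^ θ * c, b] w ≤ X ![c, b] w * X ![d, b] w ^ θ := by
  have hκ0 : 0 < κ := one_pos.trans hκ
  have hwκ := summable_weight_of_le hb (mul_pos hκ0 hc) hκd hw
  have hwc := summable_weight_of_le hb hc (le_mul_of_one_le_left hc.le hκ.le) hwκ
  have hXc := one_le_X (fun i => (forall_pair_pos hc hb i).le) hwc
  have hXκ := one_le_X (fun i => (forall_pair_pos (mul_pos hκ0 hc) hb i).le) hwκ
  have hgeom : κ ^ θ * c = c ^ (1 - θ) * (κ * c) ^ θ := by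
    rw [Real.mul_rpow hκ0.le hc.le, mul_left_comm, ← Real.rpow_add hc, sub_add_cancel,
      Real.rpow_one]
  calc X ![κ ^ θ * c, b] w
      ≤ X ![c, b] w ^ (1 - θ) * X ![κ * c, b] w ^ θ := by
        rw [hgeom]
        simpa only [X_pair_eq_monomialSum] using monomialSum_rpow_mul_rpow_le
          (weight_one_pair_nonneg hb w) hc.le (mul_pos hκ0 hc).le hθ hθ1
          (summable_weight_pair_iff.1 hwc) (summable_weight_pair_iff.1 hwκ)
    _ ≤ X ![c, b] w ^ (1 : ℝ) * X ![d, b] w ^ θ := by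
        gcongr
        · linarith
        · exact X_le_X_of_le hb (mul_pos hκ0 hc) hκd hw
    _ = X ![c, b] w * X ![d, b] w ^ θ := by rw [Real.rpow_one]

theorem XDeriv_nonneg {lam : Fin 2 → ℝ} (hlam : ∀ i, 0 ≤ lam i) (j : ℕ) (w : ℕ → Fin 2) :
    0 ≤ XDeriv lam j w :=
  mul_nonneg (div_nonneg (Nat.cast_nonneg _) (pow_nonneg (hlam 0) j))
    (tsum_nonneg fun _ => mul_nonneg (weight_nonneg hlam w _) (Nat.cast_nonneg _))

-- Cauchy's estimate with the radius `κ ^ θ * c - c`, combined with log-convexity: the quotient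
-- `XDeriv / X` is controlled by an arbitrarily small power of `X` at a larger first ratio.
theorem XDeriv_le {c₀ : ℝ} (hb : 0 < b) (hc₀ : 0 < c₀) (hc : c₀ ≤ c) (hκ : 1 < κ)
    (hκd : κ * c ≤ d) (hθ : 0 < θ) (hθ1 : θ < 1) (hw : Summable (weight ![d, b] w)) {j : ℕ}
    (hj : j ≠ 0) :
    XDeriv ![c, b] j w ≤
      j.factorial / (c₀ * (κ ^ θ - 1)) ^ j * (X ![c, b] w * X ![d, b] w ^ θ) := by
  have hc' : 0 < c := hc₀.trans_le hc
  have hκθ : 1 < κ ^ θ := Real.one_lt_rpow hκ hθ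
  have hκθ' : κ ^ θ ≤ κ := Real.rpow_le_self_of_one_le hκ.le hθ1.le
  have hρ : 0 < c₀ * (κ ^ θ - 1) := mul_pos hc₀ (sub_pos.2 hκθ)
  have hρ_le : c₀ * (κ ^ θ - 1) ≤ κ ^ θ * c - c := by nlinarith
  have hwθ : Summable (weight ![κ ^ θ * c, b] w) :=
    summable_weight_of_le hb (by positivity) (le_trans (by gcongr) hκd) hw
  have hβ := weight_one_pair_nonneg hb w
  have hcauchy : monomialCoeff (weight ![1, b] w) (firstCount w) j c * (c₀ * (κ ^ θ - 1)) ^ j ≤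
      X ![κ ^ θ * c, b] w := by
    rw [X_pair_eq_monomialSum]
    refine le_trans ?_ (monomialCoeff_mul_pow_le hβ hc'.le (by nlinarith)
      (summable_weight_pair_iff.1 hwθ) j)
    exact mul_le_mul_of_nonneg_left (by gcongr) (monomialCoeff_nonneg hβ hc'.le j)
  rw [XDeriv_pair_eq_factorial_mul_monomialCoeff hc'.ne' b hj, div_mul_eq_mul_div,
    le_div_iff₀ (pow_pos hρ j), mul_assoc]
  exact mul_le_mul_of_nonneg_left (hcauchy.trans (X_rpow_mul_le hb hc' hκ hκd hθ hθ1 hw))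
    (Nat.cast_nonneg _)

theorem abs_formalDeriv_le_of_XDeriv_le {φ : ℝ → ℝ} {t Z : ℝ} {lam : Fin 2 → ℝ}
    {B M : ℕ → ℝ} (hlam : ∀ i, 0 ≤ lam i) (hX : 0 < X lam w) (hZ : 1 ≤ Z) (l : ℕ)
    (hφ : ∀ k, |iteratedDeriv k φ (X lam w)| ≤ B k * X lam w ^ (t - k))
    (hM : ∀ j, j ≠ 0 → XDeriv lam j w ≤ M j * (X lam w * Z)) :
    |formalDeriv φ lam l w| ≤
      (∑ k ∈ tuples l, |coeffL l k| * B (∑ j, k j) * ∏ j : Fin l, |M (j + 1)| ^ k j) *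
        (X lam w ^ t * Z ^ l) := by
  rw [formalDeriv, Finset.sum_mul]
  refine (Finset.abs_sum_le_sum_abs _ _).trans (Finset.sum_le_sum fun k hk => ?_)
  have hB : 0 ≤ B (∑ j, k j) :=
    nonneg_of_mul_nonneg_left ((abs_nonneg _).trans (hφ _)) (Real.rpow_pos_of_pos hX _)
  have hprod : |∏ j : Fin l, XDeriv lam (j + 1) w ^ k j| ≤
      (∏ j : Fin l, |M (j + 1)| ^ k j) * (X lam w * Z) ^ ∑ j, k j := by
    rw [Finset.abs_prod, ← Finset.prod_pow_eq_pow_sum, ← Finset.prod_mul_distrib]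
    refine Finset.prod_le_prod (fun _ _ => abs_nonneg _) fun j _ => ?_
    rw [abs_of_nonneg (pow_nonneg (XDeriv_nonneg hlam _ w) _), ← mul_pow]
    refine pow_le_pow_left₀ (XDeriv_nonneg hlam _ w) ((hM _ j.val.succ_ne_zero).trans ?_) _
    gcongr
    exact le_abs_self _
  have hpow : X lam w ^ (t - (∑ j, k j : ℕ)) * (X lam w * Z) ^ (∑ j, k j) ≤
      X lam w ^ t * Z ^ l := by
    rw [Real.rpow_sub hX, Real.rpow_natCast, mul_pow, ← mul_assoc,
      div_mul_cancel₀ _ (pow_ne_zero _ hX.ne')]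
    gcongr
    exact sum_le_of_mem_tuples hk
  calc |coeffL l k * iteratedDeriv (∑ j, k j) φ (X lam w) * ∏ j : Fin l, XDeriv lam (j + 1) w ^ k j|
      ≤ |coeffL l k| * (B (∑ j, k j) * X lam w ^ (t - (∑ j, k j : ℕ))) *
          ((∏ j : Fin l, |M (j + 1)| ^ k j) * (X lam w * Z) ^ ∑ j, k j) := by
        rw [abs_mul, abs_mul]
        gcongr
        exact hφ _
    _ = |coeffL l k| * B (∑ j, k j) * (∏ j : Fin l, |M (j + 1)| ^ k j) *
          (X lam w ^ (t - (∑ j, k j : ℕ)) * (X lam w * Z) ^ ∑ j, k j) := by ring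
    _ ≤ |coeffL l k| * B (∑ j, k j) * (∏ j : Fin l, |M (j + 1)| ^ k j) *
          (X lam w ^ t * Z ^ l) := by gcongr

theorem exists_abs_formalDeriv_le {φ : ℝ → ℝ} {t s c₀ : ℝ} (hφ : HasSymbolGrowth φ t)
    (ht : 0 ≤ t) (hts : t < s) (hb : 0 < b) (hc₀ : 0 < c₀) (hκ : 1 < κ) (l : ℕ) :
    ∃ C : ℝ, ∀ w c d, c₀ ≤ c → κ * c ≤ d → Summable (weight ![d, b] w) →
      |formalDeriv φ ![c, b] l w| ≤ C * X ![d, b] w ^ s := by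
  obtain ⟨θ, ⟨hθ1, hθs⟩, hθ⟩ : ∃ θ : ℝ, (θ < 1 ∧ t + θ * l < s) ∧ 0 < θ := by
    have hlim : Tendsto (fun θ : ℝ => t + θ * l) (𝓝[>] 0) (𝓝 t) :=
      tendsto_nhdsWithin_of_tendsto_nhds (Continuous.tendsto' (by fun_prop) 0 t (by simp))
    exact (((eventually_lt_nhds one_pos).filter_mono nhdsWithin_le_nhds).and
      (hlim.eventually_lt_const hts) |>.and self_mem_nhdsWithin).exists
  choose B hB using hφ.exists_bound
  let M : ℕ → ℝ := fun j => j.factorial / (c₀ * (κ ^ θ - 1)) ^ j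
  refine ⟨|∑ k ∈ tuples l, |coeffL l k| * B (∑ j, k j) * ∏ j : Fin l, |M (j + 1)| ^ k j|,
    fun w c d hc hκd hw => ?_⟩
  have hc' : 0 < c := hc₀.trans_le hc
  have hcd : c ≤ d := (le_mul_of_one_le_left hc'.le hκ.le).trans hκd
  have hlam : ∀ i, 0 ≤ ![c, b] i := fun i => (forall_pair_pos hc' hb i).le
  have hXc := one_le_X hlam (summable_weight_of_le hb hc' hcd hw)
  have hXd := one_le_X (fun i => (forall_pair_pos (hc'.trans_le hcd) hb i).le) hw
  have hXcd := X_le_X_of_le hb hc' hcd hw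
  have hpow : X ![c, b] w ^ t * (X ![d, b] w ^ θ) ^ l ≤ X ![d, b] w ^ s :=
    calc X ![c, b] w ^ t * (X ![d, b] w ^ θ) ^ l
        ≤ X ![d, b] w ^ t * (X ![d, b] w ^ θ) ^ l := by gcongr
      _ = X ![d, b] w ^ (t + θ * l) := by
        rw [← Real.rpow_mul_natCast (by linarith), Real.rpow_add (by linarith)]
      _ ≤ X ![d, b] w ^ s := Real.rpow_le_rpow_of_exponent_le hXd hθs.le
  calc |formalDeriv φ ![c, b] l w|
      ≤ _ * (X ![c, b] w ^ t * (X ![d, b] w ^ θ) ^ l) :=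
        abs_formalDeriv_le_of_XDeriv_le hlam (by linarith) (Real.one_le_rpow hXd hθ.le) l
          (fun k => hB k _ hXc) (M := M) fun j hj => XDeriv_le hb hc₀ hc hκ hκd hθ hθ1 hw hj
    _ ≤ _ := mul_le_mul (le_abs_self _) hpow (by positivity) (abs_nonneg _)

end Bounds

section Response

theorem exists_gt_ratioMoment_lt_one {c b t : ℝ} (hc : 0 < c) (hb : 0 < b)
    (hm : ratioMoment ![c, b] t < 1) :
    ∃ d > c, ∃ s > t, ratioMoment ![d, b] s < 1 := by
  have hcont : ContinuousAt (fun p : ℝ => ratioMoment ![c + p, b] (t + p)) 0 :=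
    ((ContinuousAt.rpow (by fun_prop) (by fun_prop) (.inl (by simpa using hc.ne'))).add
      (ContinuousAt.rpow (by fun_prop) (by fun_prop) (.inl hb.ne'))).div_const 2
  have hlt : ∀ᶠ p in 𝓝[>] (0 : ℝ), ratioMoment ![c + p, b] (t + p) < 1 :=
    (hcont.tendsto.mono_left nhdsWithin_le_nhds).eventually_lt_const (by simpa using hm)
  obtain ⟨p, hp, hp0⟩ := (hlt.and self_mem_nhdsWithin).exists
  exact ⟨c + p, lt_add_of_pos_right c hp0, t + p, lt_add_of_pos_right t hp0, hp⟩

theorem isOpen_setOf_ratioMoment_lt_one (b t : ℝ) :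
    IsOpen {c | 0 < c ∧ ratioMoment ![c, b] t < 1} := by
  have hcont : ContinuousOn (fun c => ratioMoment ![c, b] t) (Set.Ioi 0) :=
    fun c (hc : 0 < c) => (((continuousAt_id.rpow_const (.inl hc.ne')).add
      continuousAt_const).div_const 2).continuousWithinAt
  exact hcont.isOpen_inter_preimage isOpen_Ioi isOpen_Iio

variable {φ : ℝ → ℝ} {t b c : ℝ}

theorem exists_nhds_integrable_bound_formalDeriv (hφ : HasSymbolGrowth φ t) (ht : 0 ≤ t)
    (hb : 0 < b) (hc : 0 < c) (hm : ratioMoment ![c, b] t < 1) (l : ℕ) :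
    ∃ V ∈ 𝓝 c, ∃ bound : (ℕ → Fin 2) → ℝ, Integrable bound bernoulli ∧
      ∀ᵐ w ∂bernoulli, ∀ e ∈ V, |formalDeriv φ ![e, b] l w| ≤ bound w := by
  obtain ⟨d, hcd, s, hts, hm'⟩ := exists_gt_ratioMoment_lt_one hc hb hm
  obtain ⟨e, hce, hed⟩ := exists_between hcd
  have he : 0 < e := hc.trans hce
  have hlam := forall_pair_pos (he.trans hed) hb
  have hs : 0 < s := ht.trans_lt hts
  obtain ⟨C, hC⟩ := exists_abs_formalDeriv_le hφ ht hts hb (half_pos hc) ((one_lt_div he).2 hed) l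
  refine ⟨Set.Ioo (c / 2) e, Ioo_mem_nhds (half_lt_self hc) hce, fun w => C * X ![d, b] w ^ s,
    (integrable_X_rpow hlam hs hm').const_mul C, ?_⟩
  filter_upwards [ae_summable_weight_of_ratioMoment_lt_one hlam hs hm'] with w hw c' hc'
  refine hC w c' d hc'.1.le ?_ hw
  rw [div_mul_eq_mul_div, div_le_iff₀ he]
  exact mul_le_mul_of_nonneg_left hc'.2.le (he.trans hed).le

theorem integrable_formalDeriv (hφ : HasSymbolGrowth φ t) (ht : 0 ≤ t) (hb : 0 < b) (hc : 0 < c)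
    (hm : ratioMoment ![c, b] t < 1) (l : ℕ) : Integrable (formalDeriv φ ![c, b] l) bernoulli := by
  obtain ⟨V, hV, bound, hbound, hle⟩ :=
    exists_nhds_integrable_bound_formalDeriv hφ ht hb hc hm l
  exact hbound.mono' (measurable_formalDeriv hφ.measurable _ l).aestronglyMeasurable
    (hle.mono fun w hw => hw c (mem_of_mem_nhds hV))

theorem hasDerivAt_integral_formalDeriv (hφ : HasSymbolGrowth φ t) (ht : 0 < t) (hb : 0 < b)
    (hc : 0 < c) (hm : ratioMoment ![c, b] t < 1) (l : ℕ) :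
    HasDerivAt (fun c => ∫ w, formalDeriv φ ![c, b] l w ∂bernoulli)
      (∫ w, formalDeriv φ ![c, b] (l + 1) w ∂bernoulli) c := by
  have hcb : c < 1 / b := (lt_div_iff₀ hb).2
    (mul_lt_one_of_ratioMoment_lt_one (forall_pair_pos hc hb) ht hm)
  obtain ⟨V, hV, bound, hbound, hle⟩ :=
    exists_nhds_integrable_bound_formalDeriv hφ ht.le hb hc hm (l + 1)
  have hmeas : ∀ c l, AEStronglyMeasurable (formalDeriv φ ![c, b] l) bernoulli := fun c l =>
    (measurable_formalDeriv hφ.measurable _ l).aestronglyMeasurable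
  refine (hasDerivAt_integral_of_dominated_loc_of_deriv_le
    (inter_mem hV (Ioo_mem_nhds hc hcb)) (.of_forall fun c => hmeas c l)
    (integrable_formalDeriv hφ ht.le hb hc hm l) (hmeas c (l + 1))
    (hle.mono fun w hw e he => hw e he.1) hbound ?_).2
  filter_upwards [ae_forall_summable_weight hb] with w hw e ⟨_, he, heb⟩
  obtain ⟨d, hed, hdb⟩ := exists_between heb
  exact hasDerivAt_formalDeriv hφ hb he hed
    (hw d (he.trans hed) ((lt_div_iff₀ hb).1 hdb)) l

theorem contDiffAt_integral_comp_X (hφ : HasSymbolGrowth φ t) (ht : 0 < t) (hb : 0 < b)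
    (hc : 0 < c) (hm : ratioMoment ![c, b] t < 1) :
    ContDiffAt ℝ ∞ (fun c => ∫ w, φ (X ![c, b] w) ∂bernoulli) c := by
  simp only [← formalDeriv_zero φ]
  have hU := isOpen_setOf_ratioMoment_lt_one b t
  exact (contDiffOn_infty_of_hasDerivAt hU
    (fun l c h => hasDerivAt_integral_formalDeriv hφ ht hb h.1 h.2 l) 0).contDiffAt
    (hU.mem_nhds ⟨hc, hm⟩)

theorem iteratedDeriv_integral_comp_X (hφ : HasSymbolGrowth φ t) (ht : 0 < t) (hb : 0 < b)
    (hc : 0 < c) (hm : ratioMoment ![c, b] t < 1) (l : ℕ) :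
    iteratedDeriv l (fun c => ∫ w, φ (X ![c, b] w) ∂bernoulli) c =
      ∫ w, formalDeriv φ ![c, b] l w ∂bernoulli := by
  simp only [← formalDeriv_zero φ]
  exact eqOn_iteratedDeriv_of_hasDerivAt (isOpen_setOf_ratioMoment_lt_one b t)
    (fun l c h => hasDerivAt_integral_formalDeriv hφ ht hb h.1 h.2 l) l ⟨hc, hm⟩

end Response

section StationaryFamily

theorem IsStationary.ae_one_le {lam : Fin 2 → ℝ} {μ : Measure ℝ} (hlam : ∀ i, 0 < lam i)
    (h : lam 0 * lam 1 < 1) (hμ : IsStationary lam μ) : ∀ᵐ x ∂μ, 1 ≤ x := by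
  rw [hμ.eq_map_X hlam h, ae_map_iff (measurable_X lam).aemeasurable measurableSet_Ici]
  exact (ae_summable_weight hlam h).mono fun w hw => one_le_X (fun i => (hlam i).le) hw

variable {φ : ℝ → ℝ} {t b c : ℝ} {μ : ℝ → Measure ℝ}

theorem eventually_isStationary_and_ratioMoment_lt_one (hc : 0 < c)
    (hm : ratioMoment ![c, b] t < 1) (hμ : ∀ᶠ ε in 𝓝 0, IsStationary ![c + ε, b] (μ ε)) :
    ∀ᶠ ε in 𝓝 0, IsStationary ![c + ε, b] (μ ε) ∧ 0 < c + ε ∧ ratioMoment ![c + ε, b] t < 1 :=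
  hμ.and <| (Continuous.tendsto' (by fun_prop) 0 c (add_zero c)).eventually
    ((isOpen_setOf_ratioMoment_lt_one b t).mem_nhds ⟨hc, hm⟩)

theorem eventually_ae_one_le_and_integrable (hφ : HasSymbolGrowth φ t) (ht : 0 < t) (hb : 0 < b)
    (hc : 0 < c) (hm : ratioMoment ![c, b] t < 1)
    (hμ : ∀ᶠ ε in 𝓝 0, IsStationary ![c + ε, b] (μ ε)) :
    ∀ᶠ ε in 𝓝 0, (∀ᵐ x ∂μ ε, 1 ≤ x) ∧ Integrable φ (μ ε) := by
  filter_upwards [eventually_isStationary_and_ratioMoment_lt_one hc hm hμ] with ε ⟨hμε, hε, hmε⟩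
  have hlam := forall_pair_pos hε hb
  have hlt := mul_lt_one_of_ratioMoment_lt_one hlam ht hmε
  refine ⟨hμε.ae_one_le hlam hlt, ?_⟩
  rw [hμε.eq_map_X hlam hlt, integrable_map_measure hφ.measurable.aestronglyMeasurable
    (measurable_X _).aemeasurable]
  exact (integrable_formalDeriv hφ ht.le hb hε hmε 0).congr
    (.of_forall fun w => formalDeriv_zero φ _ w)

theorem eventuallyEq_integral_comp_X (hφ : Measurable φ) (ht : 0 < t) (hb : 0 < b)
    (hc : 0 < c) (hm : ratioMoment ![c, b] t < 1)
    (hμ : ∀ᶠ ε in 𝓝 0, IsStationary ![c + ε, b] (μ ε)) :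
    (fun ε => ∫ x, φ x ∂μ ε) =ᶠ[𝓝 0] fun ε => ∫ w, φ (X ![c + ε, b] w) ∂bernoulli := by
  filter_upwards [eventually_isStationary_and_ratioMoment_lt_one hc hm hμ] with ε ⟨hμε, hε, hmε⟩
  have hlam := forall_pair_pos hε hb
  rw [hμε.eq_map_X hlam (mul_lt_one_of_ratioMoment_lt_one hlam ht hmε),
    integral_map (measurable_X _).aemeasurable hφ.aestronglyMeasurable]

theorem contDiffAt_integral_isStationary (hφ : HasSymbolGrowth φ t) (ht : 0 < t) (hb : 0 < b)
    (hc : 0 < c) (hm : ratioMoment ![c, b] t < 1)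
    (hμ : ∀ᶠ ε in 𝓝 0, IsStationary ![c + ε, b] (μ ε)) :
    ContDiffAt ℝ ∞ (fun ε => ∫ x, φ x ∂μ ε) 0 :=
  (contDiffAt_zero_comp_const_add
    (contDiffAt_integral_comp_X hφ ht hb hc hm)).congr_of_eventuallyEq
    (eventuallyEq_integral_comp_X hφ.measurable ht hb hc hm hμ)

theorem iteratedDeriv_integral_isStationary (hφ : HasSymbolGrowth φ t) (ht : 0 < t) (hb : 0 < b)
    (hc : 0 < c) (hm : ratioMoment ![c, b] t < 1)
    (hμ : ∀ᶠ ε in 𝓝 0, IsStationary ![c + ε, b] (μ ε)) (l : ℕ) :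
    iteratedDeriv l (fun ε => ∫ x, φ x ∂μ ε) 0 = ∫ w, formalDeriv φ ![c, b] l w ∂bernoulli := by
  rw [(eventuallyEq_integral_comp_X hφ.measurable ht hb hc hm hμ).iteratedDeriv_eq l,
    iteratedDeriv_zero_comp_const_add (f := fun c => ∫ w, φ (X ![c, b] w) ∂bernoulli),
    iteratedDeriv_integral_comp_X hφ ht hb hc hm l]

end StationaryFamily

end LinearResponse

end

open LinearResponse in
theorem mainTheorem3_general (lam₁ lam₂ t : ℝ) (φ : ℝ → ℝ) (hφ : HasSymbolGrowth φ t)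
    (hpos₁ : 0 < lam₁) (hpos₂ : 0 < lam₂) (ht : 0 < t) (hmoment : (lam₁ ^ t + lam₂ ^ t) / 2 < 1) :
    lam₁ * lam₂ < 1 ∧
    (∀ ε : ℝ, 0 < lam₁ + ε → (lam₁ + ε) * lam₂ < 1 →
      ∃! μ : Measure ℝ, IsStationary ![lam₁ + ε, lam₂] μ) ∧
    (∀ᵐ w ∂LinearResponse.bernoulli,
      (∀ ε : ℝ, 0 < lam₁ + ε → (lam₁ + ε) * lam₂ < 1 →
        Summable fun m : ℕ => weight ![lam₁ + ε, lam₂] w m) ∧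
      ContDiffAt ℝ ∞ (fun ε : ℝ => X ![lam₁ + ε, lam₂] w) 0 ∧
      ∀ j : ℕ, 1 ≤ j →
        (Summable fun m : ℕ => weight ![lam₁, lam₂] w (m + 1) *
          ((firstCount w (m + 1)).choose j : ℝ)) ∧
        iteratedDeriv j (fun ε : ℝ => X ![lam₁ + ε, lam₂] w) 0 = XDeriv ![lam₁, lam₂] j w) ∧
    ∀ μ : ℝ → Measure ℝ,
      (∀ᶠ ε in 𝓝 (0 : ℝ), IsStationary ![lam₁ + ε, lam₂] (μ ε)) →
      (∀ᶠ ε in 𝓝 (0 : ℝ), (∀ᵐ x ∂μ ε, 1 ≤ x) ∧ Integrable φ (μ ε)) ∧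
      ContDiffAt ℝ ∞ (fun ε : ℝ => ∫ x, φ x ∂μ ε) 0 ∧
      ∀ l : ℕ,
        (∀ᵐ w ∂LinearResponse.bernoulli,
          iteratedDeriv l (fun ε : ℝ => φ (X ![lam₁ + ε, lam₂] w)) 0 =
            formalDeriv φ ![lam₁, lam₂] l w) ∧
        Integrable (fun w => iteratedDeriv l (fun ε : ℝ => φ (X ![lam₁ + ε, lam₂] w)) 0)
          LinearResponse.bernoulli ∧
        Integrable (formalDeriv φ ![lam₁, lam₂] l) LinearResponse.bernoulli ∧
        iteratedDeriv l (fun ε : ℝ => ∫ x, φ x ∂μ ε) 0 =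
          ∫ w, iteratedDeriv l (fun ε : ℝ => φ (X ![lam₁ + ε, lam₂] w)) 0
            ∂LinearResponse.bernoulli ∧
        iteratedDeriv l (fun ε : ℝ => ∫ x, φ x ∂μ ε) 0 =
          ∫ w, formalDeriv φ ![lam₁, lam₂] l w ∂LinearResponse.bernoulli := by
  have hlam := forall_pair_pos hpos₁ hpos₂
  have hm : ratioMoment ![lam₁, lam₂] t < 1 := hmoment
  have hab : lam₁ * lam₂ < 1 := mul_lt_one_of_ratioMoment_lt_one hlam ht hm
  obtain ⟨d, hd, hdb⟩ := exists_between ((lt_div_iff₀ hpos₂).2 hab)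
  have hwd : ∀ᵐ w ∂LinearResponse.bernoulli, Summable (weight ![d, lam₂] w) :=
    ae_summable_weight (forall_pair_pos (hpos₁.trans hd) hpos₂) ((lt_div_iff₀ hpos₂).1 hdb)
  refine ⟨hab, fun ε hε hεb => existsUnique_isStationary (forall_pair_pos hε hpos₂) hεb, ?_, ?_⟩
  · filter_upwards [ae_forall_summable_weight hpos₂, hwd] with w hw hwd
    have hX := (analyticAt_X hpos₂ hpos₁ hd hwd).contDiffAt (n := ∞)
    refine ⟨fun ε => hw (lam₁ + ε), contDiffAt_zero_comp_const_add hX, fun j hj =>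
      ⟨(summable_nat_add_iff 1).2 (summable_weight_mul_choose hpos₂ hpos₁ hd hwd j), ?_⟩⟩
    rw [iteratedDeriv_zero_comp_const_add (f := fun c => X ![c, lam₂] w),
      iteratedDeriv_X hpos₂ hpos₁ hd hwd (Nat.one_le_iff_ne_zero.1 hj)]
  · intro μ hμ
    refine ⟨eventually_ae_one_le_and_integrable hφ ht hpos₂ hpos₁ hm hμ,
      contDiffAt_integral_isStationary hφ ht hpos₂ hpos₁ hm hμ, fun l => ?_⟩
    have hderiv := hwd.mono fun w hw => (iteratedDeriv_zero_comp_const_add l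
      (f := fun c => φ (X ![c, lam₂] w))).trans (iteratedDeriv_comp_X hφ hpos₂ hpos₁ hd hw l)
    have hint := integrable_formalDeriv hφ ht.le hpos₂ hpos₁ hm l
    have hresponse := iteratedDeriv_integral_isStationary hφ ht hpos₂ hpos₁ hm hμ l
    exact ⟨hderiv, (integrable_congr hderiv).2 hint, hint,
      hresponse.trans (integral_congr_ae hderiv).symm, hresponse⟩

theorem mainTheorem3 (lam₁ lam₂ t : ℝ) (hpos : 0 < lam₁) (hlt : lam₁ < 1) (hgt : 1 < lam₂)
    (ht : 0 < t) (hmoment : (lam₁ ^ t + lam₂ ^ t) / 2 < 1) :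
    -- the system is contracting on average and the stationary measures are well defined
    lam₁ * lam₂ < 1 ∧
    (∀ ε : ℝ, 0 < lam₁ + ε → (lam₁ + ε) * lam₂ < 1 →
      ∃! μ : Measure ℝ, LinearResponse.IsStationary ![lam₁ + ε, lam₂] μ) ∧
    -- for almost every word the series for `X(ε)` and its formal derivatives converge,
    -- and `X(ε)` is smooth at `0` with these derivatives
    (∀ᵐ w ∂LinearResponse.bernoulli,
      (∀ ε : ℝ, 0 < lam₁ + ε → (lam₁ + ε) * lam₂ < 1 →
        Summable fun m : ℕ => LinearResponse.weight ![lam₁ + ε, lam₂] w m) ∧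
      ContDiffAt ℝ ∞ (fun ε : ℝ => LinearResponse.X ![lam₁ + ε, lam₂] w) 0 ∧
      ∀ j : ℕ, 1 ≤ j →
        (Summable fun m : ℕ => LinearResponse.weight ![lam₁, lam₂] w (m + 1) *
          ((LinearResponse.firstCount w (m + 1)).choose j : ℝ)) ∧
        iteratedDeriv j (fun ε : ℝ => LinearResponse.X ![lam₁ + ε, lam₂] w) 0 =
          LinearResponse.XDeriv ![lam₁, lam₂] j w) ∧
    -- linear response for the `t`-th moment
    ∀ μ : ℝ → Measure ℝ,
      (∀ᶠ ε in 𝓝 (0 : ℝ), LinearResponse.IsStationary ![lam₁ + ε, lam₂] (μ ε)) →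
      (∀ᶠ ε in 𝓝 (0 : ℝ),
        (∀ᵐ x ∂μ ε, 1 ≤ x) ∧ Integrable (fun x : ℝ => x ^ t) (μ ε)) ∧
      ContDiffAt ℝ ∞ (fun ε : ℝ => ∫ x, x ^ t ∂μ ε) 0 ∧
      ∀ l : ℕ,
        (∀ᵐ w ∂LinearResponse.bernoulli,
          iteratedDeriv l (fun ε : ℝ => LinearResponse.X ![lam₁ + ε, lam₂] w ^ t) 0 =
            LinearResponse.formalDeriv (fun x : ℝ => x ^ t) ![lam₁, lam₂] l w) ∧
        Integrable (fun w => iteratedDeriv l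
          (fun ε : ℝ => LinearResponse.X ![lam₁ + ε, lam₂] w ^ t) 0)
          LinearResponse.bernoulli ∧
        Integrable (LinearResponse.formalDeriv (fun x : ℝ => x ^ t) ![lam₁, lam₂] l)
          LinearResponse.bernoulli ∧
        iteratedDeriv l (fun ε : ℝ => ∫ x, x ^ t ∂μ ε) 0 =
          ∫ w, iteratedDeriv l
            (fun ε : ℝ => LinearResponse.X ![lam₁ + ε, lam₂] w ^ t) 0
            ∂LinearResponse.bernoulli ∧
        iteratedDeriv l (fun ε : ℝ => ∫ x, x ^ t ∂μ ε) 0 =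
          ∫ w, LinearResponse.formalDeriv (fun x : ℝ => x ^ t) ![lam₁, lam₂] l w
            ∂LinearResponse.bernoulli :=
  mainTheorem3_general lam₁ lam₂ t (fun x => x ^ t) (LinearResponse.hasSymbolGrowth_rpow t) hpos
    (one_pos.trans hgt) ht hmoment
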